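/- Let $p\ge 2$ be an integer and let $\zeta\in\mathbb C$ be a primitive $p$-th root of unity. If $\mathcal H$ is an infinite-dimensional complex Hilbert space, then there exists a sequence $\{u_n\}_{n\in\mathbb N}$ of unitary operators on $\mathcal H$ such that $u_n^p=1$ for every $n$ (that is, each $u_n$ is of $p$-th order), such that $u_ku_\ell=\zeta u_\ell u_k$ whenever $k<\ell$, and such that the norm-closed algebra generated by $\{u_n\}_{n\in\mathbb N}$ is closed under adjoints and is $*$-isomorphic to the UHF C$^*$-algebra $\bigotimes_1^\infty \mathrm M_p(\mathbb C)$. Here $\bigotimes_1^\infty \mathrm M_p(\mathbb C)$ denotes the C$^*$-inductive limit of the matrix algebras $\bigotimes_1^k \mathrm M_p(\mathbb C)$, $k\ge 0$, along the unital embeddings $a\mapsto a\otimes 1$. -/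

import Mathlib

open scoped Matrix.Norms.L2Operator Kronecker

noncomputable section

namespace InfTensor

/-- The C⋆-algebra `⨂₁ᵏ M_p(ℂ)`, realised through the Kronecker product as the algebra of complex
matrices whose rows and columns are indexed by the words of length `k` in `p` letters: the
elementary tensor `a₁ ⊗ ⋯ ⊗ a_k` is the matrix with entries `∏ i, a_i (f i) (g i)`, and the norm is
the operator norm on `ℓ²`. -/
abbrev MatPow (p k : ℕ) : Type := Matrix (Fin k → Fin p) (Fin k → Fin p) ℂ

/-- A word of length `l` is a word of length `k ≤ l` (its first `k` letters) together with its
remaining letters. -/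
def splitWord (p : ℕ) {k l : ℕ} (h : k ≤ l) :
    (Fin l → Fin p) ≃ (Fin k → Fin p) × ({i : Fin l // ¬ (i : ℕ) < k} → Fin p) :=
  (Equiv.piEquivPiSubtypeProd (fun i : Fin l => (i : ℕ) < k) fun _ => Fin p).trans
    (Equiv.prodCongr
      (Equiv.arrowCongr (Fin.castLEquiv h).symm (Equiv.refl (Fin p)))
      (Equiv.refl _))

/-- The connecting unital ⋆-homomorphism `⨂₁ᵏ M_p(ℂ) → ⨂₁ˡ M_p(ℂ)`, `a ↦ a ⊗ 1 ⊗ ⋯ ⊗ 1`. -/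
def amplify (p k l : ℕ) (h : k ≤ l) : MatPow p k →⋆ₐ[ℂ] MatPow p l where
  toFun a := (a ⊗ₖ (1 : Matrix ({i : Fin l // ¬ (i : ℕ) < k} → Fin p) _ ℂ)).submatrix
    (splitWord p h) (splitWord p h)
  map_one' := by simp
  map_mul' a b := by
    rw [Matrix.submatrix_mul_equiv, ← Matrix.mul_kronecker_mul, one_mul]
  map_zero' := by simp
  map_add' a b := by rw [Matrix.add_kronecker, Matrix.submatrix_add]; rfl
  commutes' r := by
    simp [Algebra.algebraMap_eq_smul_one, Matrix.smul_kronecker, Matrix.submatrix_smul]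
  map_star' a := by
    simp [Matrix.star_eq_conjTranspose, Matrix.conjTranspose_kronecker]

theorem amplify_apply {p k l : ℕ} (h : k ≤ l) (a : MatPow p k) (f g : Fin l → Fin p) :
    amplify p k l h a f g =
      if ∀ i : Fin l, k ≤ i → f i = g i
      then a (fun i => f (Fin.castLE h i)) (fun i => g (Fin.castLE h i)) else 0 := by
  have e : (splitWord p h f).2 = (splitWord p h g).2 ↔ ∀ i : Fin l, k ≤ i → f i = g i := by
    constructor
    · intro H i hi
      exact congrFun H ⟨i, not_lt.mpr hi⟩
    · intro H
      funext i
      exact H i.1 (not_lt.mp i.2)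
  change a (splitWord p h f).1 (splitWord p h g).1 *
    (1 : Matrix _ _ ℂ) (splitWord p h f).2 (splitWord p h g).2 = _
  rw [Matrix.one_apply]
  simp only [e]
  split_ifs
  · rw [mul_one]; rfl
  · rw [mul_zero]

instance instDirectedSystem (p : ℕ) :
    DirectedSystem (MatPow p) fun k l h => (amplify p k l h : MatPow p k → MatPow p l) where
  map_self k a := by
    ext f g
    rw [amplify_apply, if_pos fun i hi => absurd i.2 (not_lt.mpr hi)]
    rfl
  map_map m l k hkl hlm a := by
    ext f g
    rw [amplify_apply, amplify_apply, amplify_apply]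
    by_cases H : ∀ i : Fin m, k ≤ i → f i = g i
    · rw [if_pos H, if_pos fun i hi => H i (hkl.trans hi), if_pos]
      · rfl
      · exact fun i hi => H _ hi
    · rw [if_neg H]
      split_ifs with h1 h2
      · refine absurd (fun i hi => ?_) H
        by_cases hil : (i : ℕ) < l
        · exact h2 ⟨i, hil⟩ hi
        · exact h1 i (not_lt.mp hil)
      · rfl
      · rfl

theorem amplify_injective (p : ℕ) [NeZero p] {k l : ℕ} (h : k ≤ l) :
    Function.Injective (amplify p k l h) := by
  intro a b hab
  ext f g
  let x : (Fin k → Fin p) → Fin l → Fin p := fun u i => if hi : (i : ℕ) < k then u ⟨i, hi⟩ else 0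
  have hx : ∀ u i, x u (Fin.castLE h i) = u i := fun u i => by simp [x]
  have H := congrFun (congrFun hab (x f)) (x g)
  have hxx : ∀ i : Fin l, k ≤ i → x f i = x g i := fun i hi => by simp [x, not_lt.mpr hi]
  rw [amplify_apply, amplify_apply, if_pos hxx, if_pos hxx] at H
  simpa [hx] using H

theorem norm_amplify (p : ℕ) [NeZero p] {k l : ℕ} (h : k ≤ l) (a : MatPow p k) :
    ‖amplify p k l h a‖ = ‖a‖ :=
  NonUnitalStarAlgHom.norm_map (amplify p k l h) (amplify_injective p h) a

/-- The algebraic infinite tensor product: the direct limit (increasing union) of the algebras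
`⨂₁ᵏ M_p(ℂ)` along `a ↦ a ⊗ 1`, as a unital complex ⋆-algebra. -/
def AlgTensor (p : ℕ) : Type := DirectLimit (MatPow p) (amplify p)

instance instRing (p : ℕ) : Ring (AlgTensor p) :=
  inferInstanceAs (Ring (DirectLimit (MatPow p) (amplify p)))

instance instStarRing (p : ℕ) : StarRing (AlgTensor p) :=
  inferInstanceAs (StarRing (DirectLimit (MatPow p) (amplify p)))

instance instAlgebra (p : ℕ) : Algebra ℂ (AlgTensor p) :=
  inferInstanceAs (Algebra ℂ (DirectLimit (MatPow p) (amplify p)))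

instance instStarModule (p : ℕ) : StarModule ℂ (AlgTensor p) :=
  inferInstanceAs (StarModule ℂ (DirectLimit (MatPow p) (amplify p)))

/-- The canonical ⋆-homomorphism of `⨂₁ᵏ M_p(ℂ)` into the algebraic infinite tensor product. -/
def of (p k : ℕ) : MatPow p k →⋆ₐ[ℂ] AlgTensor p where
  toFun a := (⟦⟨k, a⟩⟧ : DirectLimit (MatPow p) (amplify p))
  map_one' := (DirectLimit.one_def k).symm
  map_mul' a b := (DirectLimit.mul_def k a b).symm
  map_zero' := (DirectLimit.zero_def k).symm
  map_add' a b := (DirectLimit.add_def k a b).symm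
  commutes' r := (DirectLimit.algebraMap_def k r).symm
  map_star' a := (DirectLimit.star_def k a).symm

theorem exists_of {p : ℕ} (x : AlgTensor p) : ∃ k a, x = of p k a :=
  DirectLimit.exists_eq_mk (amplify p) x

theorem exists_of₂ {p : ℕ} (x y : AlgTensor p) : ∃ k a b, x = of p k a ∧ y = of p k b :=
  DirectLimit.exists_eq_mk₂ (amplify p) x y

/-- The C⋆-norm of the direct limit: the connecting maps are isometric, and the norm of an element
is the norm of any matrix that represents it. -/
def limNorm (p : ℕ) [NeZero p] : AlgTensor p → ℝ :=
  DirectLimit.lift (amplify p) (fun _ a => ‖a‖) fun _ _ h a => (norm_amplify p h a).symm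

theorem limNorm_of (p : ℕ) [NeZero p] (k : ℕ) (a : MatPow p k) : limNorm p (of p k a) = ‖a‖ := rfl

instance instNormedRing (p : ℕ) [NeZero p] : NormedRing (AlgTensor p) :=
  RingNorm.toNormedRing
    { toFun := limNorm p
      map_zero' := by
        rw [← map_zero (of p 0), limNorm_of, norm_zero]
      add_le' := fun x y => by
        obtain ⟨k, a, b, rfl, rfl⟩ := exists_of₂ x y
        rw [← map_add, limNorm_of, limNorm_of, limNorm_of]
        exact norm_add_le a b
      neg' := fun x => by
        obtain ⟨k, a, rfl⟩ := exists_of x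
        rw [← map_neg, limNorm_of, limNorm_of, norm_neg]
      mul_le' := fun x y => by
        obtain ⟨k, a, b, rfl, rfl⟩ := exists_of₂ x y
        rw [← map_mul, limNorm_of, limNorm_of, limNorm_of]
        exact norm_mul_le a b
      eq_zero_of_map_eq_zero' := fun x h => by
        obtain ⟨k, a, rfl⟩ := exists_of x
        rw [limNorm_of, norm_eq_zero] at h
        rw [h, map_zero] }

theorem norm_of (p : ℕ) [NeZero p] (k : ℕ) (a : MatPow p k) : ‖of p k a‖ = ‖a‖ := rfl

instance instNormedAlgebra (p : ℕ) [NeZero p] : NormedAlgebra ℂ (AlgTensor p) where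
  norm_smul_le r x := by
    obtain ⟨k, a, rfl⟩ := exists_of x
    rw [← map_smul, norm_of, norm_of]
    exact norm_smul_le r a

instance instCStarRing (p : ℕ) [NeZero p] : CStarRing (AlgTensor p) where
  norm_mul_self_le x := by
    obtain ⟨k, a, rfl⟩ := exists_of x
    rw [← map_star, ← map_mul, norm_of, norm_of]
    exact CStarRing.norm_mul_self_le a

section Completion

open UniformSpace

variable (A : Type*) [NormedRing A] [StarRing A] [CStarRing A] [NormedAlgebra ℂ A]
  [StarModule ℂ A]

/-- The completion of a pre-C⋆-algebra, with the involution extended by continuity, is a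
C⋆-algebra. -/
@[reducible]
def completionCStarAlgebra : CStarAlgebra (Completion A) :=
  have hs : UniformContinuous (star : A → A) := star_isometry.uniformContinuous
  have hc : Continuous (Completion.map (star : A → A)) := Completion.continuous_map
  have he : ∀ a : A, Completion.map star (a : Completion A) = (star a : A) :=
    Completion.map_coe hs
  { (inferInstance : NormedRing (Completion A)),
    (inferInstance : Algebra ℂ (Completion A)),
    (inferInstance : CompleteSpace (Completion A)) with
    norm_smul_le := norm_smul_le
    star := Completion.map star
    star_involutive := fun x => by
      refine Completion.induction_on x ?_ ?_
      · exact isClosed_eq (hc.comp hc) continuous_id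
      · intro a
        rw [he, he, star_star]
    star_mul := fun x y => by
      refine Completion.induction_on₂ x y ?_ ?_
      · exact isClosed_eq (hc.comp continuous_mul)
          ((hc.comp continuous_snd).mul (hc.comp continuous_fst))
      · intro a b
        rw [← Completion.coe_mul, he, he, he, star_mul, Completion.coe_mul]
    star_add := fun x y => by
      refine Completion.induction_on₂ x y ?_ ?_
      · exact isClosed_eq (hc.comp continuous_add)
          ((hc.comp continuous_fst).add (hc.comp continuous_snd))
      · intro a b
        rw [← Completion.coe_add, he, he, he, star_add, Completion.coe_add]
    norm_mul_self_le := fun x => by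
      refine Completion.induction_on x ?_ ?_
      · exact isClosed_le (continuous_norm.mul continuous_norm)
          (continuous_norm.comp (hc.mul continuous_id))
      · intro a
        change _ ≤ ‖Completion.map star (a : Completion A) * a‖
        rw [he, ← Completion.coe_mul, Completion.norm_coe, Completion.norm_coe]
        exact CStarRing.norm_mul_self_le a
    star_smul := fun r x => by
      refine Completion.induction_on x ?_ ?_
      · exact isClosed_eq (hc.comp (continuous_const_smul r)) (hc.const_smul (star r))
      · intro a
        change Completion.map star (r • (a : Completion A)) =
          star r • Completion.map star (a : Completion A)
        rw [he, ← Completion.coe_smul, he, star_smul, Completion.coe_smul] }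

end Completion

/-- The UHF algebra `⨂₁^∞ M_p(ℂ)`: the C⋆-algebra inductive limit of the algebras `⨂₁ᵏ M_p(ℂ)`
along the connecting maps `a ↦ a ⊗ 1`, that is, the completion of their direct limit. -/
def UHF (p : ℕ) [NeZero p] : Type := UniformSpace.Completion (AlgTensor p)

instance instCStarAlgebra (p : ℕ) [NeZero p] : CStarAlgebra (UHF p) :=
  completionCStarAlgebra (AlgTensor p)

end InfTensor

end

noncomputable section

namespace InfTensor

/-! An infinite-dimensional Hilbert space is isomorphic to the direct sum of `p` copies of itself,
so it carries isometries `S i` with orthogonal ranges summing to 1 (`exists_isCuntzFamily`). For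
words f, g of length k, the products S_f S_g* are matrix units for the k-th tensor power of M_p, and
∑ S_i S_i* = 1 makes these representations compatible with a ↦ a ⊗ 1 (`matrixHom_amplify`). They are
injective, hence isometric, and extend to the completion (`uhfHom`) with closed range.

In this picture φ(x) = ∑ S_i x S_i* is the tensor shift x ↦ 1 ⊗ x, whose values commute with the
first factor M_p. That factor contains pairwise ζ-commuting unitaries U, V, W of p-th order such
that U and V generate it: the cyclic matrix, the clock matrix and a scalar multiple of U*V
(`exists_generating_unitaries`). The sequence U, V, Wφ(U), Wφ(V), Wφ(Wφ(U)), … then satisfies the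
relations (`generator_mul_generator`). The algebra it generates contains M_p, hence W*, hence φ(u_n)
= W* u_{n+2}; being stable under φ, it contains every S_f S_g* (`range_algHom_le`). Adjoints thus
come for free, and the norm closure is the copy of the UHF algebra. -/

/-- A finite family of isometries with mutually orthogonal ranges that sum to the identity. -/
structure IsCuntzFamily {ι B : Type*} [Fintype ι] [DecidableEq ι] [Ring B] [StarRing B]
    (S : ι → B) : Prop where
  star_mul_eq : ∀ i j, star (S i) * S j = if i = j then 1 else 0
  sum_mul_star : ∑ i, S i * star (S i) = 1

/-! ### Matrix units and the shift endomorphism of a Cuntz family. -/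

namespace IsCuntzFamily

variable {ι B : Type*} [Fintype ι] [DecidableEq ι] [Ring B] [StarRing B] {S : ι → B}

theorem star_mul_self (hS : IsCuntzFamily S) (i : ι) : star (S i) * S i = 1 := by
  rw [hS.star_mul_eq, if_pos rfl]

theorem unit_mul_unit (hS : IsCuntzFamily S) (i j k l : ι) :
    S i * star (S j) * (S k * star (S l)) = if j = k then S i * star (S l) else 0 := by
  rw [mul_assoc, ← mul_assoc (star (S j)), hS.star_mul_eq]
  split_ifs <;> simp

variable [Algebra ℂ B] [StarModule ℂ B]

/-- The representation of a matrix algebra whose matrix units are the products `S i * star (S j)`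
of a Cuntz family. -/
def matrixHom (hS : IsCuntzFamily S) : Matrix ι ι ℂ →⋆ₐ[ℂ] B where
  toFun a := ∑ i, ∑ j, a i j • (S i * star (S j))
  map_one' := by
    simp [Matrix.one_apply, ite_smul, hS.sum_mul_star]
  map_mul' a b := by
    symm
    simp only [Finset.sum_mul]
    simp only [Finset.mul_sum, smul_mul_smul_comm, hS.unit_mul_unit, smul_ite,
      smul_zero, Matrix.mul_apply, Finset.sum_smul]
    refine Finset.sum_congr rfl fun i _ => ?_
    calc _ = ∑ j, ∑ l, ∑ k, if j = k then (a i j * b k l) • (S i * star (S l)) else 0 :=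
          Finset.sum_congr rfl fun j _ => Finset.sum_comm
      _ = ∑ j, ∑ l, (a i j * b j l) • (S i * star (S l)) := by simp
      _ = _ := Finset.sum_comm
  map_zero' := by simp
  map_add' a b := by simp [add_smul, Finset.sum_add_distrib]
  commutes' r := by
    simp [Algebra.algebraMap_eq_smul_one, Matrix.smul_apply, Matrix.one_apply, ite_smul,
      ← Finset.smul_sum, hS.sum_mul_star]
  map_star' a := by
    simp only [star_sum, star_smul, star_mul, star_star, Matrix.star_apply]
    exact Finset.sum_comm

theorem matrixHom_apply (hS : IsCuntzFamily S) (a : Matrix ι ι ℂ) :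
    hS.matrixHom a = ∑ i, ∑ j, a i j • (S i * star (S j)) := rfl

theorem matrixHom_single (hS : IsCuntzFamily S) (i j : ι) :
    hS.matrixHom (Matrix.single i j 1) = S i * star (S j) := by
  simp [matrixHom_apply, Matrix.single_apply, ite_and, ite_smul]

/-- Compression by the isometries recovers each matrix entry, which yields injectivity. -/
theorem star_mul_matrixHom_mul (hS : IsCuntzFamily S) (a : Matrix ι ι ℂ) (i j : ι) :
    star (S i) * hS.matrixHom a * S j = a i j • (1 : B) := by
  simp only [matrixHom_apply, Finset.mul_sum, Finset.sum_mul, mul_smul_comm, smul_mul_assoc]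
  simp only [mul_assoc, hS.star_mul_eq]
  simp [hS.star_mul_eq]

theorem matrixHom_injective [Nontrivial B] (hS : IsCuntzFamily S) :
    Function.Injective hS.matrixHom := by
  intro a b hab
  ext i j
  have h := hS.star_mul_matrixHom_mul a i j
  rw [hab, hS.star_mul_matrixHom_mul] at h
  exact (smul_left_injective ℂ (one_ne_zero (α := B)) h).symm

/-- The unital ⋆-endomorphism `x ↦ ∑ i, S i * x * star (S i)`. -/
def shift (hS : IsCuntzFamily S) : B →⋆ₐ[ℂ] B where
  toFun x := ∑ i, S i * x * star (S i)
  map_one' := by simp [hS.sum_mul_star]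
  map_mul' x y := by
    simp only [Finset.sum_mul_sum]
    refine Finset.sum_congr rfl fun i _ => ?_
    rw [Finset.sum_eq_single_of_mem i (Finset.mem_univ i)]
    · rw [show S i * x * star (S i) * (S i * y * star (S i)) =
        S i * x * (star (S i) * S i) * y * star (S i) by simp only [mul_assoc],
        hS.star_mul_self, mul_one, ← mul_assoc (S i)]
    · intro j _ hj
      rw [show S i * x * star (S i) * (S j * y * star (S j)) =
        S i * x * (star (S i) * S j) * y * star (S j) by simp only [mul_assoc],
        hS.star_mul_eq, if_neg hj.symm]
      simp
  map_zero' := by simp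
  map_add' x y := by simp [mul_add, add_mul, Finset.sum_add_distrib]
  commutes' r := by
    simp [Algebra.algebraMap_eq_smul_one, ← Finset.smul_sum, hS.sum_mul_star]
  map_star' x := by simp [star_sum, mul_assoc]

omit [StarModule ℂ B] in
theorem shift_apply (hS : IsCuntzFamily S) (x : B) :
    hS.shift x = ∑ i, S i * x * star (S i) := rfl

omit [StarModule ℂ B] in
-- Orthogonality of the ranges kills every summand but one. In tensor terms, e_ij (1 ⊗ x) = e_ij ⊗
-- x.
theorem unit_mul_shift (hS : IsCuntzFamily S) (i j : ι) (x : B) :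
    S i * star (S j) * hS.shift x = S i * x * star (S j) := by
  rw [shift_apply, Finset.mul_sum, Finset.sum_eq_single_of_mem j (Finset.mem_univ j)]
  · rw [show S i * star (S j) * (S j * x * star (S j)) =
      S i * (star (S j) * S j) * x * star (S j) by simp only [mul_assoc], hS.star_mul_self, mul_one]
  · intro k _ hk
    rw [show S i * star (S j) * (S k * x * star (S k)) =
      S i * (star (S j) * S k) * x * star (S k) by simp only [mul_assoc], hS.star_mul_eq,
      if_neg hk.symm]
    simp

theorem shift_mul_unit (hS : IsCuntzFamily S) (i j : ι) (x : B) :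
    hS.shift x * (S i * star (S j)) = S i * x * star (S j) := by
  apply star_injective
  rw [star_mul, ← map_star, star_mul, star_star, unit_mul_shift]
  simp [mul_assoc]

theorem commute_matrixHom_shift (hS : IsCuntzFamily S) (a : Matrix ι ι ℂ) (x : B) :
    Commute (hS.matrixHom a) (hS.shift x) := by
  simp only [Commute, SemiconjBy, matrixHom_apply, Finset.sum_mul, Finset.mul_sum, smul_mul_assoc,
    mul_smul_comm, unit_mul_shift, shift_mul_unit]

end IsCuntzFamily

/-! ### Words in a Cuntz family and the algebraic infinite tensor product. -/

section Words

variable {B : Type*} [Ring B] [StarRing B] {p : ℕ}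

/-- The product of the members of the family `S` along a word. -/
def wordProd (S : Fin p → B) (k : ℕ) (f : Fin k → Fin p) : B :=
  (List.ofFn fun i => S (f i)).prod

omit [StarRing B] in
-- Words are extended at both ends: the shift adds a tensor factor in front, whereas `amplify` adds
-- one at the back.
theorem wordProd_cons (S : Fin p → B) (k : ℕ) (i : Fin p) (f : Fin k → Fin p) :
    wordProd S (k + 1) (Fin.cons i f : Fin (k + 1) → Fin p) = S i * wordProd S k f := by
  simp [wordProd, List.ofFn_succ]

omit [StarRing B] in
theorem wordProd_snoc (S : Fin p → B) (k : ℕ) (f : Fin k → Fin p) (i : Fin p) :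
    wordProd S (k + 1) (Fin.snoc f i : Fin (k + 1) → Fin p) = wordProd S k f * S i := by
  simp [wordProd, List.ofFn_succ_last, -List.ofFn_succ]

omit [StarRing B] in
theorem wordProd_zero (S : Fin p → B) (f : Fin 0 → Fin p) : wordProd S 0 f = 1 := by
  simp [wordProd]

theorem sum_cons {M : Type*} [AddCommMonoid M] (k : ℕ) (F : (Fin (k + 1) → Fin p) → M) :
    ∑ f, F f = ∑ i, ∑ f : Fin k → Fin p, F (Fin.cons i f : Fin (k + 1) → Fin p) := by
  rw [← Fintype.sum_prod_type', ← (Fin.consEquiv fun _ => Fin p).sum_comp]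
  rfl

theorem sum_snoc {M : Type*} [AddCommMonoid M] (k : ℕ) (F : (Fin (k + 1) → Fin p) → M) :
    ∑ f, F f = ∑ f : Fin k → Fin p, ∑ i, F (Fin.snoc f i : Fin (k + 1) → Fin p) := by
  rw [Finset.sum_comm, ← Fintype.sum_prod_type', ← (Fin.snocEquiv fun _ => Fin p).sum_comp]
  rfl

/-- Peeling off the first letter reduces both relations to those of `S` and of shorter words. This
turns `matrixHom` into a representation of `MatPow p k`. -/
theorem IsCuntzFamily.wordProd {S : Fin p → B} (hS : IsCuntzFamily S) (k : ℕ) :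
    IsCuntzFamily (wordProd S k) := by
  induction k with
  | zero =>
    refine ⟨fun f g => ?_, ?_⟩
    · rw [if_pos (Subsingleton.elim f g)]
      simp [wordProd_zero]
    · simp [wordProd_zero]
  | succ k ih =>
    refine ⟨fun f g => ?_, ?_⟩
    · induction f using Fin.consCases with | _ i f
      induction g using Fin.consCases with | _ j g
      rw [wordProd_cons, wordProd_cons, star_mul, mul_assoc, ← mul_assoc (star (S i)),
        hS.star_mul_eq]
      by_cases hij : i = j
      · simp [hij, ih.star_mul_eq]
      · simp [hij]
    · rw [sum_cons]
      have h := ih.sum_mul_star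
      calc _ = ∑ i, S i * (∑ f, InfTensor.wordProd S k f * star (InfTensor.wordProd S k f)) *
            star (S i) := by
            refine Finset.sum_congr rfl fun i _ => ?_
            rw [Finset.mul_sum, Finset.sum_mul]
            refine Finset.sum_congr rfl fun f _ => ?_
            rw [wordProd_cons, star_mul]
            simp only [mul_assoc]
        _ = 1 := by simp [h, hS.sum_mul_star]

variable [Algebra ℂ B] [StarModule ℂ B] {S : Fin p → B}

omit [StarModule ℂ B] in
theorem shift_wordProd (hS : IsCuntzFamily S) (k : ℕ) (f g : Fin k → Fin p) :
    hS.shift (wordProd S k f * star (wordProd S k g)) =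
      ∑ i, wordProd S (k + 1) (Fin.cons i f : Fin (k + 1) → Fin p) *
        star (wordProd S (k + 1) (Fin.cons i g : Fin (k + 1) → Fin p)) := by
  simp only [wordProd_cons, IsCuntzFamily.shift_apply, star_mul, mul_assoc]

theorem amplify_succ_apply (k : ℕ) (a : MatPow p k) (f g : Fin k → Fin p) (i j : Fin p) :
    amplify p k (k + 1) k.le_succ a (Fin.snoc f i : Fin (k + 1) → Fin p)
      (Fin.snoc g j : Fin (k + 1) → Fin p) = if i = j then a f g else 0 := by
  rw [amplify_apply]
  have h1 : ∀ (f : Fin k → Fin p) (i : Fin p),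
      (fun m => (Fin.snoc f i : Fin (k + 1) → Fin p) (Fin.castLE k.le_succ m)) = f := by
    intro f i
    ext1 m
    exact Fin.snoc_castSucc (α := fun _ => Fin p) i f m
  rw [h1, h1]
  congr 1
  rw [eq_iff_iff]
  constructor
  · intro h
    simpa using h (Fin.last k) le_rfl
  · rintro rfl m hm
    obtain rfl : m = Fin.last k := Fin.ext (le_antisymm (Fin.le_last m) hm)
    simp

/-- Tensoring with 1 repeats one extra last letter i on both sides of a matrix unit, and the sum
over i inserts ∑ S_i S_i* = 1 in the middle. -/
theorem matrixHom_amplify (hS : IsCuntzFamily S) {k l : ℕ} (h : k ≤ l) (a : MatPow p k) :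
    (hS.wordProd l).matrixHom (amplify p k l h a) = (hS.wordProd k).matrixHom a := by
  induction l, h using Nat.le_induction with
  | base => rw [DirectedSystem.map_self' (amplify p)]
  | succ l h ih =>
    rw [← ih, ← DirectedSystem.map_map' (amplify p) h l.le_succ]
    generalize amplify p k l h a = b
    simp only [IsCuntzFamily.matrixHom_apply, sum_snoc, amplify_succ_apply]
    refine Finset.sum_congr rfl fun f _ => ?_
    rw [Finset.sum_comm]
    refine Finset.sum_congr rfl fun g _ => ?_
    simp only [ite_smul, zero_smul, Finset.sum_ite_eq, Finset.mem_univ, if_true, ← Finset.smul_sum]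
    congr 1
    simp only [wordProd_snoc, star_mul]
    calc _ = wordProd S l f * (∑ i, S i * star (S i)) * star (wordProd S l g) := by
          simp only [Finset.mul_sum, Finset.sum_mul, mul_assoc]
      _ = _ := by rw [hS.sum_mul_star, mul_one]

/-- The map underlying the representation `algHom`. -/
def algFun (hS : IsCuntzFamily S) : AlgTensor p → B :=
  DirectLimit.lift (amplify p) (fun k a => (hS.wordProd k).matrixHom a)
    fun _ _ h a => (matrixHom_amplify hS h a).symm

theorem algFun_of (hS : IsCuntzFamily S) (k : ℕ) (a : MatPow p k) :
    algFun hS (of p k a) = (hS.wordProd k).matrixHom a := rfl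

/-- The representation of the algebraic infinite tensor product given by a Cuntz family. -/
def algHom (hS : IsCuntzFamily S) : AlgTensor p →⋆ₐ[ℂ] B where
  toFun := algFun hS
  map_one' := by rw [← map_one (of p 0), algFun_of, map_one]
  map_zero' := by rw [← map_zero (of p 0), algFun_of, map_zero]
  map_mul' x y := by
    obtain ⟨k, a, b, rfl, rfl⟩ := exists_of₂ x y
    rw [← map_mul, algFun_of, algFun_of, algFun_of, map_mul]
  map_add' x y := by
    obtain ⟨k, a, b, rfl, rfl⟩ := exists_of₂ x y
    rw [← map_add, algFun_of, algFun_of, algFun_of, map_add]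
  commutes' r := by
    rw [← AlgHomClass.commutes (of p 0), algFun_of, AlgHomClass.commutes]
  map_star' x := by
    obtain ⟨k, a, rfl⟩ := exists_of x
    rw [← map_star, algFun_of, algFun_of, map_star]

theorem algHom_of (hS : IsCuntzFamily S) (k : ℕ) (a : MatPow p k) :
    algHom hS (of p k a) = (hS.wordProd k).matrixHom a := rfl

theorem wordProd_mul_star_mem_range (hS : IsCuntzFamily S) (k : ℕ) (f g : Fin k → Fin p) :
    wordProd S k f * star (wordProd S k g) ∈ (algHom hS).range :=
  ⟨of p k (Matrix.single f g 1), by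
    change algHom hS _ = _
    rw [algHom_of, IsCuntzFamily.matrixHom_single]⟩

theorem matrixHom_mem_range (hS : IsCuntzFamily S) (a : Matrix (Fin p) (Fin p) ℂ) :
    hS.matrixHom a ∈ (algHom hS).range := by
  rw [IsCuntzFamily.matrixHom_apply]
  refine sum_mem fun i _ => sum_mem fun j _ => SMulMemClass.smul_mem _ ?_
  simpa [wordProd_cons, wordProd_zero] using
    wordProd_mul_star_mem_range hS 1 (Fin.cons i Fin.elim0) (Fin.cons j Fin.elim0)

theorem shift_mem_range (hS : IsCuntzFamily S) {x : B} (hx : x ∈ (algHom hS).range) :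
    hS.shift x ∈ (algHom hS).range := by
  obtain ⟨y, rfl⟩ := hx
  obtain ⟨k, a, rfl⟩ := exists_of y
  change hS.shift (algHom hS _) ∈ _
  rw [algHom_of, IsCuntzFamily.matrixHom_apply]
  simp only [map_sum, map_smul, shift_wordProd]
  exact sum_mem fun f _ => sum_mem fun g _ => SMulMemClass.smul_mem _ <| sum_mem fun i _ =>
    wordProd_mul_star_mem_range hS _ _ _

/-- Since S_i x S_j* = (S_i S_j*) φ(x), the matrix units of longer words arise from those of shorter
ones by one shift and one product. -/
theorem range_algHom_le (hS : IsCuntzFamily S) {A : Subalgebra ℂ B}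
    (h₁ : ∀ i j, S i * star (S j) ∈ A) (h₂ : ∀ x ∈ A, hS.shift x ∈ A) :
    (algHom hS).range.toSubalgebra ≤ A := by
  have key : ∀ k (f g : Fin k → Fin p), wordProd S k f * star (wordProd S k g) ∈ A := by
    intro k
    induction k with
    | zero => intro f g; simp [wordProd_zero]
    | succ k ih =>
      intro f g
      induction f using Fin.consCases with | _ i f
      induction g using Fin.consCases with | _ j g
      have h := A.mul_mem (h₁ i j) (h₂ _ (ih f g))
      rw [hS.unit_mul_shift] at h
      simpa only [wordProd_cons, star_mul, mul_assoc] using h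
  rintro _ ⟨y, rfl⟩
  obtain ⟨k, a, rfl⟩ := exists_of y
  change algHom hS _ ∈ _
  rw [algHom_of, IsCuntzFamily.matrixHom_apply]
  exact sum_mem fun f _ => sum_mem fun g _ => A.smul_mem (key k f g) _

end Words

/-! ### Extension to the UHF algebra. -/

section Completion

variable {B : Type*} [CStarAlgebra B] [Nontrivial B] {p : ℕ} [NeZero p] {S : Fin p → B}

theorem norm_algHom (hS : IsCuntzFamily S) (x : AlgTensor p) : ‖algHom hS x‖ = ‖x‖ := by
  obtain ⟨k, a, rfl⟩ := exists_of x
  rw [algHom_of, norm_of]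
  exact NonUnitalStarAlgHom.norm_map _ (hS.wordProd k).matrixHom_injective a

theorem isometry_algHom (hS : IsCuntzFamily S) : Isometry (algHom hS) :=
  AddMonoidHomClass.isometry_of_norm _ (norm_algHom hS)

open UniformSpace in
/-- The representation of the UHF algebra given by a Cuntz family. -/
def uhfHom (hS : IsCuntzFamily S) : UHF p →⋆ₐ[ℂ] B where
  __ := Completion.extensionHom (algHom hS : AlgTensor p →+* B) (isometry_algHom hS).continuous
  commutes' r := by
    change Completion.extension (algHom hS) ((algebraMap ℂ (AlgTensor p) r : AlgTensor p) :
      Completion (AlgTensor p)) = _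
    rw [Completion.extension_coe (isometry_algHom hS).uniformContinuous, AlgHomClass.commutes]
  map_star' x := by
    have hs : UniformContinuous (star : AlgTensor p → AlgTensor p) :=
      star_isometry.uniformContinuous
    change Completion.extension (algHom hS) (Completion.map star x) =
      star (Completion.extension (algHom hS) x)
    refine Completion.induction_on x (isClosed_eq ?_ ?_) fun a => ?_
    · exact Completion.continuous_extension.comp Completion.continuous_map
    · exact continuous_star.comp Completion.continuous_extension
    · rw [Completion.map_coe hs, Completion.extension_coe (isometry_algHom hS).uniformContinuous,
        Completion.extension_coe (isometry_algHom hS).uniformContinuous, map_star]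

theorem isometry_uhfHom (hS : IsCuntzFamily S) : Isometry (uhfHom hS) :=
  (isometry_algHom hS).completion_extension

/-- An isometric image of a complete space is closed, and the algebraic part is dense. -/
theorem range_uhfHom (hS : IsCuntzFamily S) :
    (uhfHom hS).range.toSubalgebra = (algHom hS).range.toSubalgebra.topologicalClosure := by
  apply SetLike.coe_injective
  change Set.range (uhfHom hS) = closure (Set.range (algHom hS))
  have h1 : ∀ a : AlgTensor p,
      uhfHom hS (a : UniformSpace.Completion (AlgTensor p)) = algHom hS a := fun a =>
    UniformSpace.Completion.extension_coe (isometry_algHom hS).uniformContinuous a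
  apply Set.Subset.antisymm
  · rintro _ ⟨x, rfl⟩
    refine UniformSpace.Completion.induction_on (p := fun x => uhfHom hS x ∈ _) x ?_ fun a => ?_
    · exact isClosed_closure.preimage (isometry_uhfHom hS).continuous
    · rw [h1]
      exact subset_closure ⟨a, rfl⟩
  · refine closure_minimal ?_ (isometry_uhfHom hS).isClosedEmbedding.isClosed_range
    rintro _ ⟨a, rfl⟩
    exact ⟨_, h1 a⟩

end Completion

/-! ### Existence of a Cuntz family on an infinite-dimensional Hilbert space. -/

section HilbertSpace

variable {H : Type*} [NormedAddCommGroup H] [InnerProductSpace ℂ H]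

/-- The operator that sends the `i`-th vector of a Hilbert basis to the `i`-th vector of an
orthonormal family. -/
def basisIsometry [CompleteSpace H] {ι : Type*} (b : HilbertBasis ι ℂ H) {v : ι → H}
    (hv : Orthonormal ℂ v) : H →ₗᵢ[ℂ] H :=
  hv.orthogonalFamily.linearIsometry.comp b.repr.toLinearIsometry

theorem basisIsometry_apply [CompleteSpace H] {ι : Type*} (b : HilbertBasis ι ℂ H) {v : ι → H}
    (hv : Orthonormal ℂ v) (i : ι) : basisIsometry b hv (b i) = v i := by
  classical
  change hv.orthogonalFamily.linearIsometry (b.repr (b i)) = v i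
  rw [b.repr_self]
  exact (OrthogonalFamily.linearIsometry_apply_single _ _).trans (by simp)

/-- A Hilbert basis is infinite here, and an infinite cardinal absorbs the nonzero finite factor
`p`. -/
theorem exists_hilbertBasis_equiv [CompleteSpace H] (hH : ¬ FiniteDimensional ℂ H) (p : ℕ)
    [NeZero p] : ∃ (w : Set H) (_ : HilbertBasis w ℂ H), Nonempty (Fin p × w ≃ w) := by
  obtain ⟨w, b, -⟩ := exists_hilbertBasis ℂ H
  refine ⟨w, b, ?_⟩
  have hw : Infinite w := by
    by_contra h
    rw [not_infinite_iff_finite] at h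
    have := Fintype.ofFinite w
    exact hH (Module.Basis.finiteDimensional_of_finite b.toOrthonormalBasis.toBasis)
  rw [← Cardinal.lift_mk_eq']
  simp only [Cardinal.mk_prod, Cardinal.mk_fin, Cardinal.lift_natCast,
    Cardinal.lift_id, Cardinal.lift_id']
  exact Cardinal.mul_eq_right (Cardinal.aleph0_le_mk w)
    ((Cardinal.natCast_le_aleph0).trans (Cardinal.aleph0_le_mk w))
    (by exact_mod_cast NeZero.ne p)

theorem _root_.HilbertBasis.clm_ext {ι : Type*} (b : HilbertBasis ι ℂ H) {S T : H →L[ℂ] H}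
    (h : ∀ i, S (b i) = T (b i)) : S = T :=
  ContinuousLinearMap.ext_on (Submodule.dense_iff_topologicalClosure_eq_top.mpr b.dense_span)
    (by rintro _ ⟨i, rfl⟩; exact h i)

theorem _root_.HilbertBasis.eq_of_inner {ι : Type*} (b : HilbertBasis ι ℂ H) {x y : H}
    (h : ∀ i, inner ℂ (b i) x = inner ℂ (b i) y) : x = y := by
  apply b.repr.injective
  ext i
  rw [b.repr_apply_apply, b.repr_apply_apply, h]

/-- The bijection `e` cuts the basis into `p` pieces indexed by the whole basis; `S i` carries the
basis onto the i-th piece. -/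
theorem exists_isCuntzFamily [CompleteSpace H] (hH : ¬ FiniteDimensional ℂ H) (p : ℕ)
    [NeZero p] : ∃ S : Fin p → (H →L[ℂ] H), IsCuntzFamily S := by
  classical
  obtain ⟨w, b, ⟨e⟩⟩ := exists_hilbertBasis_equiv hH p
  have hv : ∀ i : Fin p, Orthonormal ℂ fun x => b (e (i, x)) := fun i =>
    b.orthonormal.comp _ fun x y h => by simpa using h
  let S : Fin p → (H →L[ℂ] H) := fun i => (basisIsometry b (hv i)).toContinuousLinearMap
  have hSb : ∀ i x, S i (b x) = b (e (i, x)) := fun i x => basisIsometry_apply b (hv i) x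
  have hstar : ∀ i j, star (S i) * S j = if i = j then 1 else 0 := by
    intro i j
    refine b.clm_ext fun x => b.eq_of_inner fun y => ?_
    rw [ContinuousLinearMap.star_eq_adjoint, mul_apply_eq_comp,
      ContinuousLinearMap.adjoint_inner_right, hSb, hSb]
    have h := orthonormal_iff_ite.mp b.orthonormal
    rw [h]
    split_ifs with h1 h2 h2
    · obtain rfl : y = x := by simpa [h2] using h1
      rw [one_apply_eq_self, h, if_pos rfl]
    · exact absurd (by simpa using congrArg Prod.fst (e.injective h1)) h2
    · have hyx : y ≠ x := by rintro rfl; exact h1 (by rw [h2])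
      rw [one_apply_eq_self, h, if_neg hyx]
    · simp
  refine ⟨S, hstar, b.clm_ext fun z => ?_⟩
  obtain ⟨⟨j, x⟩, rfl⟩ := e.surjective z
  -- The sum fixes the range of each `S j`, and every basis vector lies in one of these ranges.
  have h1 : (∑ i, S i * star (S i)) * S j = S j := by
    simp [Finset.sum_mul, mul_assoc, hstar]
  rw [← hSb, ← mul_apply_eq_comp, h1, one_apply_eq_self]

end HilbertSpace

/-! ### Powers of elements that commute up to a scalar. -/

section Commutation

variable {R : Type*} [Ring R] [Algebra ℂ R]

theorem pow_mul_eq_smul {x y : R} {q : ℂ} (h : y * x = q • (x * y)) (n : ℕ) :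
    y ^ n * x = q ^ n • (x * y ^ n) := by
  induction n with
  | zero => simp
  | succ n ih =>
    rw [pow_succ', mul_assoc, ih, mul_smul_comm, ← mul_assoc, h, smul_mul_assoc, smul_smul,
      ← pow_succ, mul_assoc, ← pow_succ']

/-- Only the modulus of the scalar is recorded, because the scalar is later absorbed by a p-th root.
-/
theorem exists_mul_pow_eq_smul {x y : R} {q : ℂ} (hq : ‖q‖ = 1) (h : y * x = q • (x * y)) (n : ℕ) :
    ∃ s : ℂ, ‖s‖ = 1 ∧ (x * y) ^ n = s • (x ^ n * y ^ n) := by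
  induction n with
  | zero => exact ⟨1, by simp⟩
  | succ n ih =>
    obtain ⟨s, hs, e⟩ := ih
    refine ⟨s * q ^ n, by simp [hs, hq], ?_⟩
    rw [pow_succ, e, smul_mul_assoc, mul_assoc, ← mul_assoc (y ^ n), pow_mul_eq_smul h, smul_mul_assoc,
      mul_smul_comm, smul_smul, pow_succ x, pow_succ y]
    simp only [mul_assoc]

end Commutation

/-! ### Clock and cyclic matrices. -/

section ClockShift

variable {p : ℕ} [NeZero p]

/-- The cyclic permutation matrix of size `p`. -/
def cyclicMatrix (p : ℕ) [NeZero p] : Matrix (Fin p) (Fin p) ℂ :=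
  Matrix.of fun i j => if i + 1 = j then 1 else 0

/-- The diagonal matrix of the powers of `ζ`. -/
def clockMatrix (p : ℕ) (ζ : ℂ) : Matrix (Fin p) (Fin p) ℂ :=
  Matrix.diagonal fun i => ζ ^ (i : ℕ)

theorem cyclicMatrix_pow_apply (n : ℕ) (i j : Fin p) :
    (cyclicMatrix p ^ n) i j = if i + n • 1 = j then 1 else 0 := by
  induction n generalizing i with
  | zero => simp [Matrix.one_apply]
  | succ n ih =>
    rw [pow_succ', Matrix.mul_apply]
    simp only [cyclicMatrix, Matrix.of_apply] at ih ⊢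
    simp only [ite_mul, one_mul, zero_mul, Finset.sum_ite_eq, Finset.mem_univ, if_true]
    rw [ih, add_assoc, succ_nsmul' (1 : Fin p)]

theorem cyclicMatrix_pow_self : cyclicMatrix p ^ p = 1 := by
  ext i j
  have h : p • (1 : Fin p) = 0 := by
    simpa using card_nsmul_eq_zero' (x := (1 : Fin p))
  rw [cyclicMatrix_pow_apply, h, add_zero, Matrix.one_apply]

theorem cyclicMatrix_mul_star : cyclicMatrix p * star (cyclicMatrix p) = 1 := by
  ext i j
  simp [Matrix.mul_apply, Matrix.star_apply, cyclicMatrix, Matrix.one_apply, eq_comm]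

theorem cyclicMatrix_mem_unitary : cyclicMatrix p ∈ unitary (Matrix (Fin p) (Fin p) ℂ) :=
  ⟨mul_eq_one_comm.mp cyclicMatrix_mul_star, cyclicMatrix_mul_star⟩

omit [NeZero p] in
theorem clockMatrix_pow (ζ : ℂ) (n : ℕ) :
    clockMatrix p ζ ^ n = Matrix.diagonal fun i : Fin p => (ζ ^ (i : ℕ)) ^ n := by
  rw [clockMatrix, Matrix.diagonal_pow]
  rfl

variable {ζ : ℂ}

omit [NeZero p] in
theorem clockMatrix_pow_self (hζ : ζ ^ p = 1) : clockMatrix p ζ ^ p = 1 := by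
  rw [clockMatrix_pow, ← Matrix.diagonal_one]
  congr 1
  ext i
  rw [← pow_mul, mul_comm, pow_mul, hζ, one_pow]

omit [NeZero p] in
theorem clockMatrix_mem_unitary (hζ : ‖ζ‖ = 1) :
    clockMatrix p ζ ∈ unitary (Matrix (Fin p) (Fin p) ℂ) := by
  have h : clockMatrix p ζ * star (clockMatrix p ζ) = 1 := by
    rw [clockMatrix, Matrix.star_eq_conjTranspose, Matrix.diagonal_conjTranspose,
      Matrix.diagonal_mul_diagonal, ← Matrix.diagonal_one]
    congr 1
    ext i
    simp [Complex.mul_conj, Complex.normSq_eq_norm_sq, ← mul_pow, hζ]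
  exact ⟨mul_eq_one_comm.mp h, h⟩

/-- Addition in `Fin p` reduces modulo `p`, which does not affect powers of `ζ`. -/
theorem pow_val_add_one (hζ : ζ ^ p = 1) (i : Fin p) :
    ζ ^ ((i + 1 : Fin p) : ℕ) = ζ * ζ ^ (i : ℕ) := by
  rw [Fin.val_add, ← pow_succ', ← pow_eq_pow_mod _ hζ, Fin.val_one', pow_eq_pow_mod _ hζ,
    Nat.add_mod_mod, ← pow_eq_pow_mod _ hζ]

theorem val_nsmul_one (n : ℕ) : ((n • (1 : Fin p) : Fin p) : ℕ) = n % p := by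
  induction n with
  | zero => simp
  | succ n ih => rw [succ_nsmul, Fin.val_add, ih, Fin.val_one', ← Nat.add_mod]

theorem cyclicMatrix_mul_clockMatrix (hζ : ζ ^ p = 1) :
    cyclicMatrix p * clockMatrix p ζ = ζ • (clockMatrix p ζ * cyclicMatrix p) := by
  ext i j
  rw [clockMatrix, Matrix.mul_diagonal, Matrix.smul_apply, Matrix.diagonal_mul]
  simp only [cyclicMatrix, Matrix.of_apply]
  split_ifs with h
  · rw [← h, pow_val_add_one hζ]
    simp
  · simp

/-- Fourier inversion on the cyclic group: the clock matrix has distinct eigenvalues ζ^i, and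
averaging ζ^(-im) V^m over m < p gives the i-th spectral projection. -/
theorem single_mem_of_clockMatrix_mem (hζ : IsPrimitiveRoot ζ p)
    {A : Subalgebra ℂ (Matrix (Fin p) (Fin p) ℂ)} (hV : clockMatrix p ζ ∈ A) (i : Fin p) :
    Matrix.single i i 1 ∈ A := by
  have hp : (p : ℂ) ≠ 0 := by exact_mod_cast NeZero.ne p
  have hz : ζ ≠ 0 := hζ.ne_zero (NeZero.ne p)
  have h : Matrix.single i i 1 =
      (p : ℂ)⁻¹ • ∑ m ∈ Finset.range p, ((ζ ^ (i : ℕ))⁻¹) ^ m • clockMatrix p ζ ^ m := by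
    rw [eq_inv_smul_iff₀ hp]
    simp only [clockMatrix_pow, ← Matrix.diagonal_smul]
    ext k l
    simp only [Matrix.sum_apply, Matrix.smul_apply, Matrix.single_apply, Matrix.diagonal_apply,
      Pi.smul_apply, smul_eq_mul]
    by_cases hkl : k = l
    · subst hkl
      simp only [if_true, and_self, ← mul_pow]
      by_cases hik : i = k
      · subst hik
        simp [hz]
      -- Off the i-th place the average is a full geometric sum of a p-th root of unity different
      -- from 1, so it vanishes.
      · set x := (ζ ^ (i : ℕ))⁻¹ * ζ ^ (k : ℕ) with hx
        have hx1 : x ≠ 1 := by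
          intro h
          rw [hx, inv_mul_eq_one₀ (pow_ne_zero _ hz)] at h
          exact hik (Fin.ext (hζ.pow_inj i.2 k.2 h))
        have hxp : x ^ p = 1 := by
          rw [hx, mul_pow, inv_pow, pow_right_comm ζ (i : ℕ), pow_right_comm ζ (k : ℕ),
            hζ.pow_eq_one]
          simp
        rw [if_neg hik, geom_sum_eq hx1, hxp]
        simp
    · rw [if_neg (by rintro ⟨rfl, rfl⟩; exact hkl rfl)]
      simp [hkl]
  rw [h]
  exact A.smul_mem (sum_mem fun m _ => A.smul_mem (pow_mem hV m) _) _

theorem eq_top_of_cyclicMatrix_mem_of_clockMatrix_mem (hζ : IsPrimitiveRoot ζ p)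
    {A : Subalgebra ℂ (Matrix (Fin p) (Fin p) ℂ)} (hU : cyclicMatrix p ∈ A)
    (hV : clockMatrix p ζ ∈ A) : A = ⊤ := by
  have h : ∀ i j : Fin p, Matrix.single i j 1 ∈ A := by
    intro i j
    have e : Matrix.single i j (1 : ℂ) =
        Matrix.single i i 1 * cyclicMatrix p ^ ((j - i : Fin p) : ℕ) := by
      have hn : ((j - i : Fin p) : ℕ) • (1 : Fin p) = j - i := by
        rw [Fin.ext_iff, val_nsmul_one, Nat.mod_eq_of_lt (j - i : Fin p).2]
      ext k l
      rw [Matrix.mul_apply, Finset.sum_eq_single_of_mem i (Finset.mem_univ i)]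
      · rw [cyclicMatrix_pow_apply, hn]
        by_cases hik : i = k <;> simp [hik, Matrix.single_apply]
      · intro m _ hm
        simp [hm.symm]
    rw [e]
    exact A.mul_mem (single_mem_of_clockMatrix_mem hζ hV i) (pow_mem hU _)
  rw [eq_top_iff]
  intro a _
  rw [Matrix.matrix_eq_sum_single a]
  refine sum_mem fun i _ => sum_mem fun j _ => ?_
  rw [← mul_one (a i j), ← smul_eq_mul, ← Matrix.smul_single]
  exact A.smul_mem (h i j) _

theorem exists_generating_unitaries (hζ : IsPrimitiveRoot ζ p) :
    ∃ U V W : Matrix (Fin p) (Fin p) ℂ,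
      (U ∈ unitary (Matrix (Fin p) (Fin p) ℂ) ∧ U ^ p = 1) ∧
      (V ∈ unitary (Matrix (Fin p) (Fin p) ℂ) ∧ V ^ p = 1) ∧
      (W ∈ unitary (Matrix (Fin p) (Fin p) ℂ) ∧ W ^ p = 1) ∧
      U * V = ζ • (V * U) ∧ U * W = ζ • (W * U) ∧ V * W = ζ • (W * V) ∧
      ∀ A : Subalgebra ℂ (Matrix (Fin p) (Fin p) ℂ), U ∈ A → V ∈ A → A = ⊤ := by
  have hn : ‖ζ‖ = 1 := hζ.norm'_eq_one (NeZero.ne p)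
  set U := cyclicMatrix p
  set V := clockMatrix p ζ
  have hU : U ∈ unitary (Matrix (Fin p) (Fin p) ℂ) := cyclicMatrix_mem_unitary
  have hV : V ∈ unitary (Matrix (Fin p) (Fin p) ℂ) := clockMatrix_mem_unitary hn
  have hU1 : star U * U = 1 := hU.1
  have hU2 : U * star U = 1 := hU.2
  have hUp : U ^ p = 1 := cyclicMatrix_pow_self
  have hVp : V ^ p = 1 := clockMatrix_pow_self hζ.pow_eq_one
  have hUV : U * V = ζ • (V * U) := cyclicMatrix_mul_clockMatrix hζ.pow_eq_one
  -- Multiply `hUV` by U* on both sides.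
  have hVU : V * star U = ζ • (star U * V) := by
    calc V * star U = star U * (U * V) * star U := by rw [← mul_assoc, hU1, one_mul]
      _ = ζ • (star U * V * (U * star U)) := by
        rw [hUV, mul_smul_comm, smul_mul_assoc]; simp only [mul_assoc]
      _ = _ := by rw [hU2, mul_one]
  obtain ⟨s, hs, e⟩ := exists_mul_pow_eq_smul hn hVU p
  rw [← star_pow, hUp, hVp, star_one, one_mul] at e
  -- U*V need not have order dividing `p`: its p-th power is the scalar `s`, equal to -1 when `p` is
  -- even. The factor `c` corrects this and has modulus one, so unitarity is kept.
  obtain ⟨c, hc⟩ := IsAlgClosed.exists_pow_nat_eq s⁻¹ (NeZero.pos p)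
  have hs0 : s ≠ 0 := by rintro rfl; simp at hs
  have hcn : ‖c‖ = 1 := by
    have h : ‖c‖ ^ p = 1 := by rw [← norm_pow, hc, norm_inv, hs, inv_one]
    exact (pow_eq_one_iff_of_nonneg (norm_nonneg c) (NeZero.ne p)).mp h
  have hcc : c ∈ unitary ℂ := by
    rw [Unitary.mem_iff, mul_comm c, and_self]
    simp [Complex.conj_mul', hcn]
  refine ⟨U, V, c • (star U * V), ⟨hU, hUp⟩, ⟨hV, hVp⟩, ⟨?_, ?_⟩, hUV, ?_, ?_, fun A =>
    eq_top_of_cyclicMatrix_mem_of_clockMatrix_mem hζ⟩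
  · exact Unitary.smul_mem_of_mem hcc (mul_mem (Unitary.star_mem hU) hV)
  · rw [smul_pow, e, hc, smul_smul, inv_mul_cancel₀ hs0, one_smul]
  · rw [mul_smul_comm, smul_mul_assoc, smul_comm ζ c, mul_assoc (star U), ← mul_smul_comm ζ,
      ← hUV, ← mul_assoc, ← mul_assoc, hU1, hU2]
  · rw [mul_smul_comm, ← mul_assoc, hVU, smul_mul_assoc, smul_mul_assoc, smul_comm]

end ClockShift

/-! ### The generating sequence of unitaries. -/

section Generators

variable {B : Type*} [Ring B] [StarRing B] [Algebra ℂ B] [StarModule ℂ B]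

/-- The sequence `U, V, W φ(U), W φ(V), W φ(W φ(U)), …`. -/
def generator (φ : B →⋆ₐ[ℂ] B) (U V W : B) : ℕ → B
  | 0 => U
  | 1 => V
  | n + 2 => W * φ (generator φ U V W n)

omit [StarModule ℂ B] in
theorem generator_induction {φ : B →⋆ₐ[ℂ] B} {U V W : B} {P : B → Prop} (hU : P U) (hV : P V)
    (hW : ∀ x, P x → P (W * φ x)) (n : ℕ) : P (generator φ U V W n) := by
  induction n using Nat.twoStepInduction with
  | zero => exact hU
  | one => exact hV
  | more n ih _ => exact hW _ ih

omit [StarModule ℂ B] in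
-- If k < 2, the factor φ(x) of a later term commutes with U and V, so the scalar comes from `W` (or
-- from `hUV`). Otherwise Wφ(x) Wφ(y) = W² φ(xy), which reduces the relation to both indices lowered
-- by 2.
theorem generator_mul_generator {φ : B →⋆ₐ[ℂ] B} {U V W : B} {ζ : ℂ}
    (hφU : ∀ x, Commute U (φ x)) (hφV : ∀ x, Commute V (φ x)) (hφW : ∀ x, Commute W (φ x))
    (hUV : U * V = ζ • (V * U)) (hUW : U * W = ζ • (W * U)) (hVW : V * W = ζ • (W * V))
    {k l : ℕ} (h : k < l) :
    generator φ U V W k * generator φ U V W l =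
      ζ • (generator φ U V W l * generator φ U V W k) := by
  have key : ∀ X, (∀ x, Commute X (φ x)) → X * W = ζ • (W * X) → ∀ x,
      X * (W * φ x) = ζ • (W * φ x * X) := fun X h1 h2 x => by
    rw [← mul_assoc, h2, smul_mul_assoc, mul_assoc, (h1 x).eq, mul_assoc]
  induction k using Nat.twoStepInduction generalizing l with
  | zero =>
    match l, h with
    | 1, _ => exact hUV
    | l + 2, _ => exact key U hφU hUW _
  | one =>
    match l, h with
    | l + 2, _ => exact key V hφV hVW _
  | more k ih _ =>
    match l, h with
    | l + 2, h =>
      have e : ∀ x y, W * φ x * (W * φ y) = W * W * φ (x * y) := fun x y => by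
        rw [mul_assoc, ← mul_assoc (φ x), ← (hφW x).eq, map_mul]
        simp only [mul_assoc]
      simp only [generator]
      rw [e, e, ih (by omega), map_smul, mul_smul_comm]

variable {p : ℕ} [NeZero p] {S : Fin p → B}

theorem exists_generators (hS : IsCuntzFamily S) {ζ : ℂ} (hζ : IsPrimitiveRoot ζ p) :
    ∃ u : ℕ → B, (∀ n, u n ∈ unitary B ∧ u n ^ p = 1) ∧
      (∀ k l, k < l → u k * u l = ζ • (u l * u k)) ∧
      Algebra.adjoin ℂ (Set.range u) = (algHom hS).range.toSubalgebra := by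
  obtain ⟨U, V, W, ⟨hU, hUp⟩, ⟨hV, hVp⟩, ⟨hW, hWp⟩, hUV, hUW, hVW, hgen⟩ :=
    exists_generating_unitaries hζ
  set π := hS.matrixHom with hπ
  have hpow : ∀ X, X ^ p = 1 → π X ^ p = 1 := fun X h => by rw [← map_pow, h, map_one]
  have hrel : ∀ X Y, X * Y = ζ • (Y * X) → π X * π Y = ζ • (π Y * π X) := fun X Y h => by
    rw [← map_mul, h, map_smul, map_mul]
  have hcomm : ∀ X x, Commute (π X) (hS.shift x) := hS.commute_matrixHom_shift
  set u := generator hS.shift (π U) (π V) (π W) with hu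
  refine ⟨u, fun n => ?_, fun k l h => ?_, le_antisymm ?_ ?_⟩
  · refine generator_induction (P := fun x => x ∈ unitary B ∧ x ^ p = 1)
      ⟨Unitary.map_mem _ hU, hpow U hUp⟩ ⟨Unitary.map_mem _ hV, hpow V hVp⟩ (fun x hx => ⟨?_, ?_⟩) n
    · exact mul_mem (Unitary.map_mem _ hW) (Unitary.map_mem _ hx.1)
    · rw [(hcomm W x).mul_pow, hpow W hWp, ← map_pow, hx.2, map_one, one_mul]
  · exact generator_mul_generator (hcomm U) (hcomm V) (hcomm W) (hrel U V hUV) (hrel U W hUW)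
      (hrel V W hVW) h
  · rw [Algebra.adjoin_le_iff]
    rintro _ ⟨n, rfl⟩
    exact generator_induction (P := fun x => x ∈ (algHom hS).range) (matrixHom_mem_range hS U)
      (matrixHom_mem_range hS V)
      (fun x hx => mul_mem (matrixHom_mem_range hS W) (shift_mem_range hS hx)) n
  · set A := Algebra.adjoin ℂ (Set.range u)
    have hmem : ∀ n, u n ∈ A := fun n => Algebra.subset_adjoin ⟨n, rfl⟩
    -- The first two terms are the images of U and V, so `A` contains the whole first tensor factor,
    -- including W*.
    have htop : A.comap (π : Matrix (Fin p) (Fin p) ℂ →ₐ[ℂ] B) = ⊤ :=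
      hgen _ (hmem 0) (hmem 1)
    have hπA : ∀ X, π X ∈ A := fun X => by
      have : X ∈ A.comap (π : Matrix (Fin p) (Fin p) ℂ →ₐ[ℂ] B) := htop ▸ Algebra.mem_top
      exact this
    have hshift : A ≤ A.comap (hS.shift : B →ₐ[ℂ] B) := by
      rw [Algebra.adjoin_le_iff]
      rintro _ ⟨n, rfl⟩
      -- Cancelling `W` exhibits the shift of each generator inside `A`.
      have e : hS.shift (u n) = π (star W) * u (n + 2) := by
        change _ = _ * (π W * hS.shift (u n))
        rw [← mul_assoc, ← map_mul, hW.1, map_one, one_mul]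
      change hS.shift (u n) ∈ A
      rw [e]
      exact A.mul_mem (hπA _) (hmem _)
    refine range_algHom_le hS (fun i j => ?_) fun x hx => hshift hx
    rw [← hS.matrixHom_single]
    exact hπA _

end Generators

end InfTensor

end

theorem mainTheorem7 (p : ℕ) [NeZero p] (hp : 2 ≤ p) (ζ : ℂ) (hζ : IsPrimitiveRoot ζ p)
    {H : Type*} [NormedAddCommGroup H] [InnerProductSpace ℂ H] [CompleteSpace H]
    (hH : ¬ FiniteDimensional ℂ H) :
    ∃ u : ℕ → (H →L[ℂ] H),
      (∀ n, u n ∈ unitary (H →L[ℂ] H) ∧ u n ^ p = 1) ∧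
      (∀ k l, k < l → u k * u l = ζ • (u l * u k)) ∧
      ∃ S : StarSubalgebra ℂ (H →L[ℂ] H),
        S.toSubalgebra = (Algebra.adjoin ℂ (Set.range u)).topologicalClosure ∧
        Nonempty (S ≃⋆ₐ[ℂ] InfTensor.UHF p) := by
  -- Nontriviality gives 1 ≠ 0 among the operators, on which injectivity of the matrix
  -- representations rests.
  have : Nontrivial H := by
    by_contra h
    rw [not_nontrivial_iff_subsingleton] at h
    exact hH inferInstance
  obtain ⟨S, hS⟩ := InfTensor.exists_isCuntzFamily hH p
  obtain ⟨u, hu, hrel, hadj⟩ := InfTensor.exists_generators hS hζ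
  refine ⟨u, hu, hrel, (InfTensor.uhfHom hS).range, ?_, ?_⟩
  · rw [hadj, InfTensor.range_uhfHom]
  · exact ⟨(StarAlgEquiv.ofInjective _ (InfTensor.isometry_uhfHom hS).injective).symm⟩
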